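/- Let $M\in\mathbb{C}^{p\times p}$ be Hermitian positive definite and let $E\in\mathbb{C}^{p\times q}$ be an arbitrary, possibly rank deficient, matrix. Put $$\mathcal{A}=\begin{pmatrix} M & E\\ -E^{*} & 0\end{pmatrix},\qquad B=E^{*}M^{-1}E,$$ and for real parameters $\omega_1,\omega_2,\tau$ put $$\mathcal{B}(\omega_1,\omega_2)=\begin{pmatrix} M & 0\\ -\omega_1E^{*} & B\end{pmatrix}\begin{pmatrix} M^{-1} & 0\\ 0 & B^{\dagger}\end{pmatrix}\begin{pmatrix} M & \omega_2E\\ 0 & B\end{pmatrix},$$ where $X^{\dagger}$ denotes the Moore--Penrose inverse of $X$. For $f=(f_1;f_2)\in\mathbb{C}^{p+q}$ in the range of $\mathcal{A}$, the GSTS iteration for $\mathcal{A}u=f$ is $$u_2^{(k+1)}=u_2^{(k)}+\tau B^{\dagger}\bigl[\omega_1E^{*}M^{-1}(f_1-Eu_2^{(k)})+(1-\omega_1)E^{*}u_1^{(k)}+f_2\bigr],$$ $$u_1^{(k+1)}=(1-\tau)u_1^{(k)}+M^{-1}\bigl[E\bigl((\omega_2-\tau)u_2^{(k)}-\omega_2u_2^{(k+1)}\bigr)+\tau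 f_1\bigr],$$ and its matrix form is $u^{(k+1)}=u^{(k)}-\tau\,\mathcal{B}(\omega_1,\omega_2)^{\dagger}(\mathcal{A}u^{(k)}-f)$. Such an iteration is called semi-convergent if, for every $f$ in the range of $\mathcal{A}$ and every initial guess $u^{(0)}\in\mathbb{C}^{p+q}$, the sequence $u^{(k)}$ converges to a solution of $\mathcal{A}u=f$. Let $\tilde\omega=(\omega_1-1)(\omega_2-1)$, and suppose that $\tilde\omega<2$ and that (a) if $0\le\tilde\omega<2$, then $0<\tau<2-\tilde\omega$; (b) if $\tilde\omega<0$, then $0<\tau<2-\tilde\omega-\sqrt{\tilde\omega(\tilde\omega-4)}$. Then the GSTS iteration is semi-convergent, both in its block form and in its matrix form. -/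

import Mathlib

open Matrix Filter Topology
open scoped ComplexOrder

/-! ### The Moore–Penrose inverse -/

/-- `X` is a Moore–Penrose inverse of `A`: the four Penrose equations hold. -/
def IsMoorePenroseInverse {m n : Type*} [Fintype m] [Fintype n]
    (A : Matrix m n ℂ) (X : Matrix n m ℂ) : Prop :=
  A * X * A = A ∧ X * A * X = X ∧ (A * X)ᴴ = A * X ∧ (X * A)ᴴ = X * A

theorem exists_isMoorePenroseInverse {m n : Type*} [Fintype m] [Fintype n]
    (A : Matrix m n ℂ) : ∃ X : Matrix n m ℂ, IsMoorePenroseInverse A X := by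
  classical
  have hH : (Aᴴ * A).IsHermitian := isHermitian_conjTranspose_mul_self A
  obtain ⟨Y, hY1, hY2, hY3, hY4⟩ : ∃ Y : Matrix n n ℂ, (Aᴴ * A) * Y * (Aᴴ * A) = Aᴴ * A ∧
      Y * (Aᴴ * A) * Y = Y ∧ Y * (Aᴴ * A) = (Aᴴ * A) * Y ∧ Yᴴ = Y := by
    obtain ⟨φ, d, hs⟩ : ∃ (φ : Matrix n n ℂ ≃⋆ₐ[ℂ] Matrix n n ℂ) (d : n → ℝ),
        Aᴴ * A = φ (diagonal fun i => (d i : ℂ)) := ⟨_, _, hH.spectral_theorem⟩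
    rw [hs]
    refine ⟨φ (diagonal fun i => ((d i : ℂ))⁻¹), ?_, ?_, ?_, ?_⟩
    · rw [← map_mul, ← map_mul, diagonal_mul_diagonal, diagonal_mul_diagonal]
      congr 2
      funext i
      simp
    · rw [← map_mul, ← map_mul, diagonal_mul_diagonal, diagonal_mul_diagonal]
      congr 2
      funext i
      rcases eq_or_ne (d i) 0 with h | h <;> simp [h]
    · rw [← map_mul, ← map_mul, diagonal_mul_diagonal, diagonal_mul_diagonal]
      congr 2
      funext i
      exact mul_comm _ _
    · rw [← star_eq_conjTranspose, ← map_star, star_eq_conjTranspose, diagonal_conjTranspose]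
      congr 2
      funext i
      simp
  refine ⟨Y * Aᴴ, ?_, ?_, ?_, ?_⟩
  · have h0 : (A * (Y * (Aᴴ * A)) - A)ᴴ * (A * (Y * (Aᴴ * A)) - A) = 0 := by
      have : Aᴴ * (A * (Y * (Aᴴ * A)) - A) = 0 := by
        rw [Matrix.mul_sub, ← Matrix.mul_assoc, ← Matrix.mul_assoc, hY1, sub_self]
      have e : (A * (Y * (Aᴴ * A)) - A)ᴴ = (Y * (Aᴴ * A) - 1)ᴴ * Aᴴ := by
        rw [← conjTranspose_mul, Matrix.mul_sub, Matrix.mul_one]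
      rw [e, Matrix.mul_assoc, this, Matrix.mul_zero]
    have := conjTranspose_mul_self_eq_zero.1 h0
    rw [sub_eq_zero] at this
    simpa only [Matrix.mul_assoc] using this
  · calc Y * Aᴴ * A * (Y * Aᴴ) = (Y * (Aᴴ * A) * Y) * Aᴴ := by simp only [Matrix.mul_assoc]
      _ = Y * Aᴴ := by rw [hY2]
  · simp only [conjTranspose_mul, conjTranspose_conjTranspose, hY4, Matrix.mul_assoc]
  · rw [Matrix.mul_assoc, conjTranspose_mul, hY4, hH.eq, hY3]

theorem IsMoorePenroseInverse.unique {m n : Type*} [Fintype m] [Fintype n]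
    {A : Matrix m n ℂ} {X Y : Matrix n m ℂ}
    (hX : IsMoorePenroseInverse A X) (hY : IsMoorePenroseInverse A Y) : X = Y := by
  obtain ⟨x1, x2, x3, x4⟩ := hX
  obtain ⟨y1, y2, y3, y4⟩ := hY
  have h1 : A * X = A * Y := by
    calc A * X = (A * X)ᴴ := x3.symm
      _ = ((A * Y) * (A * X))ᴴ := by rw [← Matrix.mul_assoc, y1]
      _ = (A * X) * (A * Y) := by rw [conjTranspose_mul, x3, y3]
      _ = A * Y := by rw [← Matrix.mul_assoc, x1]
  have h2 : X * A = Y * A := by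
    calc X * A = (X * A)ᴴ := x4.symm
      _ = ((X * A) * (Y * A))ᴴ := by
          rw [Matrix.mul_assoc X A, ← Matrix.mul_assoc A Y, y1]
      _ = (Y * A) * (X * A) := by rw [conjTranspose_mul, x4, y4]
      _ = Y * A := by rw [Matrix.mul_assoc Y A, ← Matrix.mul_assoc A X, x1]
  calc X = X * A * X := x2.symm
    _ = Y * A * Y := by rw [h2, Matrix.mul_assoc, h1, ← Matrix.mul_assoc]
    _ = Y := y2

/-- The Moore–Penrose inverse of a complex matrix. -/
noncomputable def moorePenrose {m n : Type*} [Fintype m] [Fintype n]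
    (A : Matrix m n ℂ) : Matrix n m ℂ :=
  Classical.choose (exists_isMoorePenroseInverse A)

theorem moorePenrose_spec {m n : Type*} [Fintype m] [Fintype n] (A : Matrix m n ℂ) :
    IsMoorePenroseInverse A (moorePenrose A) :=
  Classical.choose_spec (exists_isMoorePenroseInverse A)

/-! ### Saddle-point systems and the GSTS iteration -/

/-- The saddle-point matrix with block rows `(M, E)` and `(-Eᴴ, 0)`. -/
def saddleMatrix {m n : Type*} (M : Matrix m m ℂ) (E : Matrix m n ℂ) :
    Matrix (m ⊕ n) (m ⊕ n) ℂ :=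
  fromBlocks M E (-Eᴴ) 0

/-- The (possibly singular) GSTS preconditioner `𝓑(ω₁, ω₂)`, as a product of a block lower
triangular, a block diagonal and a block upper triangular matrix. -/
noncomputable def gstsPreconditioner {m n : Type*} [Fintype m] [DecidableEq m] [Fintype n]
    (M : Matrix m m ℂ) (E : Matrix m n ℂ) (B : Matrix n n ℂ) (ω₁ ω₂ : ℝ) :
    Matrix (m ⊕ n) (m ⊕ n) ℂ :=
  fromBlocks M 0 (-((ω₁ : ℂ) • Eᴴ)) B * fromBlocks M⁻¹ 0 0 (moorePenrose B) *
    fromBlocks M ((ω₂ : ℂ) • E) 0 B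

/-- One step `u ↦ u - τ 𝓑(ω₁, ω₂)† (𝓐 u - f)` of the GSTS iteration in matrix form. -/
noncomputable def gstsMatrixStep {m n : Type*} [Fintype m] [DecidableEq m] [Fintype n]
    (M : Matrix m m ℂ) (E : Matrix m n ℂ) (B : Matrix n n ℂ) (ω₁ ω₂ τ : ℝ)
    (f u : m ⊕ n → ℂ) : m ⊕ n → ℂ :=
  u - (τ : ℂ) • (moorePenrose (gstsPreconditioner M E B ω₁ ω₂) *ᵥ (saddleMatrix M E *ᵥ u - f))

/-- The update of the second block in one step of the GSTS iteration:
`u₂ + τ B† [ω₁ Eᴴ M⁻¹ (f₁ - E u₂) + (1 - ω₁) Eᴴ u₁ + f₂]`. -/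
noncomputable def gstsSecond {m n : Type*} [Fintype m] [DecidableEq m] [Fintype n]
    (M : Matrix m m ℂ) (E : Matrix m n ℂ) (B : Matrix n n ℂ) (ω₁ τ : ℝ)
    (f₁ : m → ℂ) (f₂ : n → ℂ) (u₁ : m → ℂ) (u₂ : n → ℂ) : n → ℂ :=
  u₂ + (τ : ℂ) • (moorePenrose B *ᵥ
    ((ω₁ : ℂ) • (Eᴴ *ᵥ (M⁻¹ *ᵥ (f₁ - E *ᵥ u₂))) + (1 - (ω₁ : ℂ)) • (Eᴴ *ᵥ u₁) + f₂))

/-- The update of the first block in one step of the GSTS iteration, where `v₂` is the already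
updated second block: `(1 - τ) u₁ + M⁻¹ [E ((ω₂ - τ) u₂ - ω₂ v₂) + τ f₁]`. -/
noncomputable def gstsFirst {m n : Type*} [Fintype m] [DecidableEq m] [Fintype n]
    (M : Matrix m m ℂ) (E : Matrix m n ℂ) (ω₂ τ : ℝ)
    (f₁ : m → ℂ) (u₁ : m → ℂ) (u₂ v₂ : n → ℂ) : m → ℂ :=
  (1 - (τ : ℂ)) • u₁ +
    M⁻¹ *ᵥ (E *ᵥ (((ω₂ : ℂ) - (τ : ℂ)) • u₂ - (ω₂ : ℂ) • v₂) + (τ : ℂ) • f₁)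

/-- One step of the GSTS iteration, computed block by block. -/
noncomputable def gstsStep {m n : Type*} [Fintype m] [DecidableEq m] [Fintype n]
    (M : Matrix m m ℂ) (E : Matrix m n ℂ) (B : Matrix n n ℂ) (ω₁ ω₂ τ : ℝ)
    (f u : m ⊕ n → ℂ) : m ⊕ n → ℂ :=
  let v₂ := gstsSecond M E B ω₁ τ (f ∘ Sum.inl) (f ∘ Sum.inr) (u ∘ Sum.inl) (u ∘ Sum.inr)
  Sum.elim (gstsFirst M E ω₂ τ (f ∘ Sum.inl) (u ∘ Sum.inl) (u ∘ Sum.inr) v₂) v₂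

/-- A stationary iteration `u⁽ᵏ⁺¹⁾ = step f u⁽ᵏ⁾` for the linear systems `A u = f` is
semi-convergent if for every right-hand side `f` in the range of `A` and every initial guess,
the iterates converge to a solution of `A u = f` (which may depend on the initial guess). -/
def IsSemiConvergent {ι : Type*} [Fintype ι] (A : Matrix ι ι ℂ)
    (step : (ι → ℂ) → (ι → ℂ) → (ι → ℂ)) : Prop :=
  ∀ f : ι → ℂ, (∃ w, A *ᵥ w = f) → ∀ u₀ : ι → ℂ,
    ∃ u : ι → ℂ, A *ᵥ u = f ∧ Tendsto (fun k : ℕ => (step f)^[k] u₀) atTop (𝓝 u)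

/-! ### Second-order linear recurrences -/

/-! Fix a solution `w` and let `x`, `y` be the block errors. With `F = M⁻¹E` and `G = B†Eᴴ`,
positive definiteness gives `FGF = F` and `GFG = G`, so `FG` and `GF` are projections that split the
errors. The part `x - FGx` shrinks by `1 - τ` per step, and `y - GFy` is frozen but lies in the
kernel of `E`, so it only changes which solution is reached. The pair `(Gx, GFy)` evolves by a
scalar 2×2 matrix with eigenvalues `1 - τλ`, where `λ² - (2 - ω)λ + 1 = 0`; the conditions on `τ`
put them in the open unit disc (`exists_gsts_roots`). The matrix form reduces to the block form
through an explicit `𝓑†` (`moorePenrose_gstsPreconditioner`). -/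

theorem tendsto_zero_of_recurrence {V : Type*} [NormedAddCommGroup V] [NormedSpace ℂ V]
    {μ ν : ℂ} (hμ : ‖μ‖ < 1) (hν : ‖ν‖ < 1) {s : ℕ → V}
    (hs : ∀ n, s (n + 2) = (μ + ν) • s (n + 1) - (μ * ν) • s n) :
    Tendsto s atTop (𝓝 0) := by
  -- Factoring the recurrence leaves a first-order one with geometric forcing.
  have hd : ∀ n, s (n + 1) - μ • s n = ν ^ n • (s 1 - μ • s 0) := by
    intro n
    induction n with
    | zero => simp
    | succ n ih =>
      rw [pow_succ', mul_smul, ← ih, hs]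
      module
  -- The `1 / 2` keeps `ρ` positive, so that division by it is allowed. The factor `n` in the bound
  -- below covers `μ = ν`.
  obtain ⟨ρ, hρ0, hρ1, hμρ, hνρ⟩ : ∃ ρ : ℝ, 0 < ρ ∧ ρ < 1 ∧ ‖μ‖ ≤ ρ ∧ ‖ν‖ ≤ ρ :=
    ⟨max (1 / 2) (max ‖μ‖ ‖ν‖), by positivity, by simp [hμ, hν]; norm_num, by simp, by simp⟩
  set D := ‖s 1 - μ • s 0‖
  have hb : ∀ n : ℕ, ‖s n‖ ≤ ρ ^ n * ‖s 0‖ + D / ρ * (n * ρ ^ n) := by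
    intro n
    induction n with
    | zero => simp
    | succ n ih =>
      have h1 : s (n + 1) = μ • s n + ν ^ n • (s 1 - μ • s 0) := by rw [← hd]; module
      calc ‖s (n + 1)‖ ≤ ‖μ‖ * ‖s n‖ + ‖ν‖ ^ n * D := by
            rw [h1]
            refine (norm_add_le _ _).trans ?_
            rw [norm_smul, norm_smul, norm_pow]
        _ ≤ ρ * (ρ ^ n * ‖s 0‖ + D / ρ * (n * ρ ^ n)) + ρ ^ n * D := by gcongr
        _ = ρ ^ (n + 1) * ‖s 0‖ + D / ρ * ((n + 1 : ℕ) * ρ ^ (n + 1)) := by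
            push_cast
            field_simp
            ring
  refine squeeze_zero_norm hb ?_
  have h1 := (tendsto_pow_atTop_nhds_zero_of_lt_one hρ0.le hρ1).mul_const ‖s 0‖
  have h2 := (tendsto_self_mul_const_pow_of_lt_one hρ0.le hρ1).const_mul (D / ρ)
  simpa using h1.add h2

/-- The quadratic with roots `μ`, `ν` is the characteristic polynomial of the two-by-two matrix
that governs the GSTS errors. -/
theorem exists_gsts_roots {τ ω : ℝ} (hω2 : ω < 2)
    (ha : 0 ≤ ω → 0 < τ ∧ τ < 2 - ω)
    (hb : ω < 0 → 0 < τ ∧ τ < 2 - ω - Real.sqrt (ω * (ω - 4))) :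
    ∃ μ ν : ℂ, ‖μ‖ < 1 ∧ ‖ν‖ < 1 ∧ μ + ν = 2 - τ * (2 - ω) ∧
      μ * ν = 1 - τ * (2 - ω) + τ ^ 2 := by
  rcases le_or_gt 0 ω with h | h
  · obtain ⟨h0, h1⟩ := ha h
    have hr : Real.sqrt (ω * (4 - ω)) ^ 2 = ω * (4 - ω) := Real.sq_sqrt (by nlinarith)
    set r := Real.sqrt (ω * (4 - ω))
    -- Here the `λ` are conjugate of modulus one, so `‖z‖² = 1 - τ(2 - ω) + τ²`, which is below 1
    -- exactly when `τ < 2 - ω`.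
    have key : ∀ z : ℂ, z.re = 1 - τ * (2 - ω) / 2 → z.im ^ 2 = (τ * r / 2) ^ 2 → ‖z‖ < 1 := by
      intro z hre him
      have : ‖z‖ ^ 2 < 1 := by
        rw [← Complex.normSq_eq_norm_sq, Complex.normSq_apply, ← sq z.im, him, hre]
        have : (τ * r / 2) ^ 2 = τ ^ 2 * (ω * (4 - ω)) / 4 := by rw [← hr]; ring
        rw [this]
        nlinarith [mul_pos h0 (sub_pos.2 h1)]
      exact (sq_lt_one_iff₀ (norm_nonneg z)).1 this
    refine ⟨⟨1 - τ * (2 - ω) / 2, τ * r / 2⟩, ⟨1 - τ * (2 - ω) / 2, -(τ * r / 2)⟩,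
      key _ rfl rfl, key _ rfl (by simp), ?_, ?_⟩
    · apply Complex.ext
      · simp only [Complex.add_re, Complex.sub_re, Complex.mul_re, Complex.sub_im, Complex.re_ofNat,
          Complex.im_ofNat, Complex.ofReal_re, Complex.ofReal_im]
        ring
      · simp
    · rw [show (1 - (τ : ℂ) * (2 - ω) + τ ^ 2) = ((1 - τ * (2 - ω) + τ ^ 2 : ℝ) : ℂ) by
        push_cast; ring]
      apply Complex.ext
      · simp only [Complex.mul_re, Complex.ofReal_re]
        linear_combination τ ^ 2 / 4 * hr
      · simp only [Complex.mul_im, Complex.ofReal_im]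
        ring
  · obtain ⟨h0, h1⟩ := hb h
    have hr : Real.sqrt (ω * (ω - 4)) ^ 2 = ω * (ω - 4) := Real.sq_sqrt (by nlinarith)
    have hr0 : 0 ≤ Real.sqrt (ω * (ω - 4)) := Real.sqrt_nonneg _
    set r := Real.sqrt (ω * (ω - 4))
    have hr2 : r < 2 - ω := by nlinarith
    -- The `λ` are now real and positive with product 1, so the binding condition `τλ < 2` for the
    -- larger one says that `τ` is below twice the smaller one.
    have hprod : (2 - ω - r) * (2 - ω + r) = 4 := by linear_combination -hr
    have hmax : τ * (2 - ω + r) < 4 := by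
      rw [← hprod]
      exact mul_lt_mul_of_pos_right h1 (by linarith)
    refine ⟨((1 - τ * (2 - ω + r) / 2 : ℝ) : ℂ), ((1 - τ * (2 - ω - r) / 2 : ℝ) : ℂ), ?_, ?_, ?_, ?_⟩
    · rw [Complex.norm_real, Real.norm_eq_abs, abs_lt]
      constructor
      · linarith
      · have := mul_pos h0 (show 0 < 2 - ω + r by linarith)
        linarith
    · rw [Complex.norm_real, Real.norm_eq_abs, abs_lt]
      have h3 := mul_pos h0 (show 0 < 2 - ω - r by linarith)
      have h4 := mul_nonneg h0.le hr0
      constructor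
      · linarith
      · linarith
    · push_cast
      ring
    · have : (1 - τ * (2 - ω + r) / 2) * (1 - τ * (2 - ω - r) / 2) = 1 - τ * (2 - ω) + τ ^ 2 := by
        linear_combination τ ^ 2 / 4 * hprod
      exact_mod_cast this

theorem abs_one_sub_lt_one_of_gsts {τ ω : ℝ}
    (ha : 0 ≤ ω → 0 < τ ∧ τ < 2 - ω)
    (hb : ω < 0 → 0 < τ ∧ τ < 2 - ω - Real.sqrt (ω * (ω - 4))) : |1 - τ| < 1 := by
  rw [abs_lt]
  rcases le_or_gt 0 ω with h | h
  · obtain ⟨h0, h1⟩ := ha h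
    constructor <;> linarith
  · obtain ⟨h0, h1⟩ := hb h
    -- Since `ω(ω - 4) ≥ ω²`, the bound on `τ` is at most 2.
    have : -ω ≤ Real.sqrt (ω * (ω - 4)) := Real.le_sqrt_of_sq_le (by nlinarith)
    constructor <;> linarith

/-! ### The error recursion -/

theorem tendsto_gsts_error {V W : Type*} [NormedAddCommGroup V] [NormedSpace ℂ V]
    [NormedAddCommGroup W] [NormedSpace ℂ W] (F : W →L[ℂ] V) (G : V →L[ℂ] W)
    (hF : ∀ y, F (G (F y)) = F y) (hG : ∀ x, G (F (G x)) = G x) {ω₁ ω₂ τ μ ν : ℂ}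
    (hμ : ‖μ‖ < 1) (hν : ‖ν‖ < 1) (hτ : ‖1 - τ‖ < 1)
    (hadd : μ + ν = 2 - τ * (2 - (ω₁ - 1) * (ω₂ - 1)))
    (hmul : μ * ν = 1 - τ * (2 - (ω₁ - 1) * (ω₂ - 1)) + τ ^ 2)
    {x : ℕ → V} {y : ℕ → W}
    (hy : ∀ k, y (k + 1) = y k - τ • ((ω₁ - 1) • G (x k) + ω₁ • G (F (y k))))
    (hx : ∀ k, x (k + 1) = (1 - τ) • x k - τ • F (y k) - ω₂ • F (y (k + 1) - y k)) :
    Tendsto x atTop (𝓝 0) ∧ Tendsto y atTop (𝓝 (y 0 - G (F (y 0)))) := by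
  have hb : ∀ k, G (F (y (k + 1))) =
      (-(τ * (ω₁ - 1))) • G (x k) + (1 - τ * ω₁) • G (F (y k)) := by
    intro k
    simp only [hy, map_sub, map_add, map_smul, hG]
    module
  have ha : ∀ k, G (x (k + 1)) =
      (1 - τ + ω₂ * τ * (ω₁ - 1)) • G (x k) + (ω₂ * τ * ω₁ - τ) • G (F (y k)) := by
    intro k
    simp only [hx, hy, map_sub, map_add, map_smul, hG]
    module
  -- By Cayley–Hamilton, each component of the 2×2 system satisfies the recurrence given by its
  -- trace and determinant.
  have hta : Tendsto (fun k => G (x k)) atTop (𝓝 0) := by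
    refine tendsto_zero_of_recurrence hμ hν fun k => ?_
    simp only [hadd, hmul, ha, hb]
    module
  have htb : Tendsto (fun k => G (F (y k))) atTop (𝓝 0) := by
    refine tendsto_zero_of_recurrence hμ hν fun k => ?_
    simp only [hadd, hmul, ha, hb]
    module
  -- The remaining terms of the update lie in the range of `F`, which `1 - FG` annihilates.
  have hc : ∀ k, x k - F (G (x k)) = (1 - τ) ^ k • (x 0 - F (G (x 0))) := by
    intro k
    induction k with
    | zero => simp
    | succ k ih =>
      rw [pow_succ', mul_smul, ← ih, ha, hx, hy]
      simp only [map_sub, map_add, map_smul, hF]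
      module
  -- The increments of `y` lie in the range of `G`, which `GF` fixes.
  have hd : ∀ k, y k - G (F (y k)) = y 0 - G (F (y 0)) := by
    intro k
    induction k with
    | zero => rfl
    | succ k ih =>
      rw [← ih, hb, hy]
      module
  constructor
  · have h1 : Tendsto (fun k => (1 - τ) ^ k • (x 0 - F (G (x 0)))) atTop (𝓝 0) := by
      simpa using (tendsto_pow_atTop_nhds_zero_of_norm_lt_one hτ).smul_const (x 0 - F (G (x 0)))
    have h2 : Tendsto (fun k => F (G (x k))) atTop (𝓝 0) := by
      simpa [Function.comp_def] using (F.continuous.tendsto 0).comp hta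
    simpa [← hc] using h1.add h2
  · have := htb.add_const (y 0 - G (F (y 0)))
    rw [zero_add] at this
    refine this.congr fun k => ?_
    rw [← hd k]
    abel

/-! ### Moore–Penrose inverses -/

section MoorePenrose

variable {m n : Type*} [Fintype m] [Fintype n]

theorem IsMoorePenroseInverse.moorePenrose_eq {A : Matrix m n ℂ} {X : Matrix n m ℂ}
    (h : IsMoorePenroseInverse A X) : moorePenrose A = X :=
  (moorePenrose_spec A).unique h

/-- Taking adjoints of the Penrose equations shows that `(A†)ᴴ` also satisfies them; uniqueness
concludes. -/
theorem Matrix.IsHermitian.moorePenrose {A : Matrix n n ℂ} (hA : A.IsHermitian) :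
    (_root_.moorePenrose A).IsHermitian := by
  obtain ⟨h1, h2, h3, h4⟩ := moorePenrose_spec A
  refine (IsMoorePenroseInverse.moorePenrose_eq ?_).symm
  have h5 : A * (_root_.moorePenrose A)ᴴ = _root_.moorePenrose A * A := by
    rw [← h4, conjTranspose_mul, hA.eq]
  have h6 : (_root_.moorePenrose A)ᴴ * A = A * _root_.moorePenrose A := by
    rw [← h3, conjTranspose_mul, hA.eq]
  refine ⟨?_, ?_, ?_, ?_⟩
  · have h7 := congrArg (fun X : Matrix n n ℂ => Xᴴ) h1
    simpa [hA.eq, Matrix.mul_assoc] using h7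
  · have h7 := congrArg (fun X : Matrix n n ℂ => Xᴴ) h2
    simpa [hA.eq, Matrix.mul_assoc] using h7
  · rw [h5, h4]
  · rw [h6, h3]

theorem Matrix.IsHermitian.moorePenrose_comm {A : Matrix n n ℂ} (hA : A.IsHermitian) :
    A * _root_.moorePenrose A = _root_.moorePenrose A * A := by
  rw [← (moorePenrose_spec A).2.2.1, conjTranspose_mul, hA.eq, hA.moorePenrose.eq]

theorem Matrix.PosDef.eq_zero_of_conjTranspose_mul_mul_eq_zero {N : Matrix m m ℂ} (hN : N.PosDef)
    {Z : Matrix m n ℂ} (h : Zᴴ * N * Z = 0) : Z = 0 := by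
  classical
  have key : ∀ v, Z *ᵥ v = 0 := by
    intro v
    by_contra hv
    have hpos := hN.dotProduct_mulVec_pos hv
    have : star (Z *ᵥ v) ⬝ᵥ N *ᵥ (Z *ᵥ v) = star v ⬝ᵥ (Zᴴ * N * Z) *ᵥ v := by
      simp only [star_mulVec, ← dotProduct_mulVec, mulVec_mulVec, Matrix.mul_assoc]
    rw [this, h] at hpos
    simp at hpos
  exact Matrix.ext_of_mulVec_single fun i => by rw [key, zero_mulVec]

end MoorePenrose

/-! ### The GSTS preconditioner -/

section GSTS

variable {m n : Type*} [Fintype m] [DecidableEq m] [Fintype n]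
  {M : Matrix m m ℂ} {E : Matrix m n ℂ} {B : Matrix n n ℂ}

theorem conjTranspose_mul_inv_mul_mul {l : Type*} (hB : B = Eᴴ * M⁻¹ * E) (X : Matrix n l ℂ) :
    Eᴴ * (M⁻¹ * (E * X)) = B * X := by
  rw [hB]
  simp only [Matrix.mul_assoc]

omit [Fintype n] in
theorem isHermitian_schur (hM : M.PosDef) (hB : B = Eᴴ * M⁻¹ * E) : B.IsHermitian := by
  rw [hB]
  exact isHermitian_conjTranspose_mul_mul E hM.isHermitian.inv

/-- `B` and `E` have the same kernel because `M⁻¹` is positive definite, and `1 - B†B` maps into the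
kernel of `B`. -/
theorem mul_moorePenrose_schur_mul (hM : M.PosDef) (hB : B = Eᴴ * M⁻¹ * E) :
    E * (moorePenrose B * B) = E := by
  classical
  have h : E * (1 - moorePenrose B * B) = 0 := by
    refine hM.inv.eq_zero_of_conjTranspose_mul_mul_eq_zero ?_
    have h1 : B * (1 - moorePenrose B * B) = 0 := by
      rw [Matrix.mul_sub, Matrix.mul_one, ← Matrix.mul_assoc, (moorePenrose_spec B).1, sub_self]
    calc (E * (1 - moorePenrose B * B))ᴴ * M⁻¹ * (E * (1 - moorePenrose B * B))
        = (1 - moorePenrose B * B)ᴴ * ((Eᴴ * M⁻¹ * E) * (1 - moorePenrose B * B)) := by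
          simp only [conjTranspose_mul, Matrix.mul_assoc]
      _ = 0 := by rw [← hB, h1, Matrix.mul_zero]
  rw [Matrix.mul_sub, Matrix.mul_one, sub_eq_zero] at h
  exact h.symm

theorem mul_moorePenrose_schur_mul_conjTranspose (hM : M.PosDef) (hB : B = Eᴴ * M⁻¹ * E) :
    B * moorePenrose B * Eᴴ = Eᴴ := by
  rw [(isHermitian_schur hM hB).moorePenrose_comm, ← (moorePenrose_spec B).2.2.2,
    ← conjTranspose_mul, mul_moorePenrose_schur_mul hM hB]

theorem gstsPreconditioner_eq (hM : M.PosDef) (hB : B = Eᴴ * M⁻¹ * E) (ω₁ ω₂ : ℝ) :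
    gstsPreconditioner M E B ω₁ ω₂ =
      fromBlocks M ((ω₂ : ℂ) • E) (-((ω₁ : ℂ) • Eᴴ)) ((1 - (ω₁ : ℂ) * ω₂) • B) := by
  have hdet : IsUnit M.det := (isUnit_iff_isUnit_det M).1 hM.isUnit
  have h1 := (moorePenrose_spec B).1
  have h2 : Eᴴ * (M⁻¹ * E) = B := by rw [hB, Matrix.mul_assoc]
  simp only [gstsPreconditioner, fromBlocks_multiply, Matrix.mul_zero, Matrix.zero_mul, add_zero,
    zero_add, h1, mul_nonsing_inv M hdet, Matrix.one_mul, Matrix.neg_mul, Matrix.smul_mul, Matrix.mul_smul,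
    nonsing_inv_mul M hdet, Matrix.mul_one, Matrix.mul_assoc (Eᴴ), h2]
  congr 1
  module

/-- This is the usual block inverse with `B†` replacing `B⁻¹`. The identities `E B†B = E` and `BB†Eᴴ
= Eᴴ` make both products block diagonal and Hermitian. -/
theorem moorePenrose_gstsPreconditioner (hM : M.PosDef) (hB : B = Eᴴ * M⁻¹ * E) (ω₁ ω₂ : ℝ) :
    moorePenrose (gstsPreconditioner M E B ω₁ ω₂) =
      fromBlocks (M⁻¹ - ((ω₁ : ℂ) * ω₂) • (M⁻¹ * (E * (moorePenrose B * (Eᴴ * M⁻¹)))))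
        (-((ω₂ : ℂ) • (M⁻¹ * (E * moorePenrose B))))
        ((ω₁ : ℂ) • (moorePenrose B * (Eᴴ * M⁻¹))) (moorePenrose B) := by
  have hdet : IsUnit M.det := (isUnit_iff_isUnit_det M).1 hM.isUnit
  obtain ⟨h1, h2, h3, h4⟩ := moorePenrose_spec B
  have hE := mul_moorePenrose_schur_mul hM hB
  have hE' : ∀ X : Matrix m m ℂ, B * (moorePenrose B * (Eᴴ * X)) = Eᴴ * X := by
    intro X
    rw [← Matrix.mul_assoc, ← Matrix.mul_assoc, mul_moorePenrose_schur_mul_conjTranspose hM hB]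
  have hS : Eᴴ * (M⁻¹ * E) = B := by rw [hB, Matrix.mul_assoc]
  rw [gstsPreconditioner_eq hM hB]
  set C := fromBlocks (M⁻¹ - ((ω₁ : ℂ) * ω₂) • (M⁻¹ * (E * (moorePenrose B * (Eᴴ * M⁻¹)))))
        (-((ω₂ : ℂ) • (M⁻¹ * (E * moorePenrose B))))
        ((ω₁ : ℂ) • (moorePenrose B * (Eᴴ * M⁻¹))) (moorePenrose B) with hC
  set A := fromBlocks M ((ω₂ : ℂ) • E) (-((ω₁ : ℂ) • Eᴴ)) ((1 - (ω₁ : ℂ) * ω₂) • B) with hA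
  have hAC : A * C = fromBlocks 1 0 0 (B * moorePenrose B) := by
    rw [hA, hC, fromBlocks_multiply]
    congr 1 <;>
    simp only [Matrix.mul_sub, Matrix.mul_neg, Matrix.neg_mul, Matrix.smul_mul, Matrix.mul_smul, smul_neg,
      mul_nonsing_inv M hdet, mul_nonsing_inv_cancel_left M _ hdet,
      conjTranspose_mul_inv_mul_mul hB, hE'] <;> module
  have hCA : C * A = fromBlocks 1 0 0 (moorePenrose B * B) := by
    rw [hA, hC, fromBlocks_multiply]
    congr 1 <;>
    simp only [Matrix.sub_mul, Matrix.mul_neg, Matrix.neg_mul, Matrix.smul_mul, Matrix.mul_smul, smul_sub,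
      smul_neg, Matrix.mul_assoc, nonsing_inv_mul M hdet, hS, hE, Matrix.mul_one] <;> module
  refine IsMoorePenroseInverse.moorePenrose_eq ⟨?_, ?_, ?_, ?_⟩
  · rw [hAC, hA, fromBlocks_multiply]
    simp only [Matrix.one_mul, Matrix.zero_mul, add_zero, zero_add, Matrix.mul_neg, Matrix.mul_smul,
      smul_zero, neg_zero,
      mul_moorePenrose_schur_mul_conjTranspose hM hB, h1]
  · rw [hCA, hC, fromBlocks_multiply]
    simp only [Matrix.one_mul, Matrix.zero_mul, add_zero, zero_add, Matrix.mul_smul, smul_zero, h2,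
      ← Matrix.mul_assoc (moorePenrose B * B)]
  · rw [hAC, fromBlocks_conjTranspose, h3]
    simp
  · rw [hCA, fromBlocks_conjTranspose, h4]
    simp

/-- The block form and the matrix form of the GSTS iteration agree. -/
theorem gstsMatrixStep_eq_gstsStep (hM : M.PosDef) (hB : B = Eᴴ * M⁻¹ * E) (ω₁ ω₂ τ : ℝ) :
    gstsMatrixStep M E B ω₁ ω₂ τ = gstsStep M E B ω₁ ω₂ τ := by
  have hdet : IsUnit M.det := (isUnit_iff_isUnit_det M).1 hM.isUnit
  have hM1 : ∀ x, M⁻¹ *ᵥ (M *ᵥ x) = x := by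
    intro x
    rw [mulVec_mulVec, nonsing_inv_mul M hdet, one_mulVec]
  funext f u
  obtain ⟨u₁, u₂, rfl⟩ : ∃ u₁ u₂, u = Sum.elim u₁ u₂ := ⟨_, _, (Sum.elim_comp_inl_inr u).symm⟩
  obtain ⟨f₁, f₂, rfl⟩ : ∃ f₁ f₂, f = Sum.elim f₁ f₂ := ⟨_, _, (Sum.elim_comp_inl_inr f).symm⟩
  have e : ∀ (a b : m → ℂ) (c d : n → ℂ),
      Sum.elim a c - Sum.elim b d = Sum.elim (a - b) (c - d) := by
    intros; ext (i | i) <;> simp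
  have e' : ∀ (t : ℂ) (a : m → ℂ) (c : n → ℂ),
      t • Sum.elim a c = Sum.elim (t • a) (t • c) := by
    intros; ext (i | i) <;> simp
  simp only [gstsMatrixStep, gstsStep, moorePenrose_gstsPreconditioner hM hB, saddleMatrix,
    fromBlocks_mulVec, Sum.elim_comp_inl, Sum.elim_comp_inr, e, e', gstsFirst, gstsSecond]
  congr 1 <;>
  simp only [sub_mulVec, neg_mulVec, smul_mulVec, ← mulVec_mulVec, mulVec_add, mulVec_sub,
    mulVec_neg, mulVec_smul, zero_mulVec, add_zero, hM1, smul_add, smul_sub, smul_neg] <;> module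

theorem isSemiConvergent_gstsStep (hM : M.PosDef) (hB : B = Eᴴ * M⁻¹ * E) {ω₁ ω₂ τ : ℝ}
    {μ ν : ℂ} (hμ : ‖μ‖ < 1) (hν : ‖ν‖ < 1) (hτ : ‖1 - (τ : ℂ)‖ < 1)
    (hadd : μ + ν = 2 - τ * (2 - ((ω₁ : ℂ) - 1) * (ω₂ - 1)))
    (hmul : μ * ν = 1 - τ * (2 - ((ω₁ : ℂ) - 1) * (ω₂ - 1)) + τ ^ 2) :
    IsSemiConvergent (saddleMatrix M E) (gstsStep M E B ω₁ ω₂ τ) := by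
  have hdet : IsUnit M.det := (isUnit_iff_isUnit_det M).1 hM.isUnit
  have hM1 : ∀ x, M⁻¹ *ᵥ (M *ᵥ x) = x := by
    intro x
    rw [mulVec_mulVec, nonsing_inv_mul M hdet, one_mulVec]
  have hS : ∀ y, Eᴴ *ᵥ (M⁻¹ *ᵥ (E *ᵥ y)) = B *ᵥ y := by
    intro y
    simp only [hB, mulVec_mulVec, Matrix.mul_assoc]
  have hE : ∀ y, E *ᵥ (moorePenrose B *ᵥ (B *ᵥ y)) = E *ᵥ y := by
    intro y
    rw [mulVec_mulVec, mulVec_mulVec, Matrix.mul_assoc, mul_moorePenrose_schur_mul hM hB]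
  have hP : ∀ y, moorePenrose B *ᵥ (B *ᵥ (moorePenrose B *ᵥ y)) = moorePenrose B *ᵥ y := by
    intro y
    rw [mulVec_mulVec, mulVec_mulVec, (moorePenrose_spec B).2.1]
  rintro f ⟨w, rfl⟩ u₀
  set f := saddleMatrix M E *ᵥ w with hf
  obtain ⟨w₁, w₂, rfl⟩ : ∃ w₁ w₂, w = Sum.elim w₁ w₂ := ⟨_, _, (Sum.elim_comp_inl_inr w).symm⟩
  have hf₁ : f ∘ Sum.inl = M *ᵥ w₁ + E *ᵥ w₂ := by simp [hf, saddleMatrix, fromBlocks_mulVec]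
  have hf₂ : f ∘ Sum.inr = -(Eᴴ *ᵥ w₁) := by simp [hf, saddleMatrix, fromBlocks_mulVec, neg_mulVec]
  set u : ℕ → m ⊕ n → ℂ := fun k => (gstsStep M E B ω₁ ω₂ τ f)^[k] u₀ with hu
  have hu1 : ∀ k, u (k + 1) = gstsStep M E B ω₁ ω₂ τ f (u k) := fun k =>
    Function.iterate_succ_apply' _ _ _
  set F : (n → ℂ) →L[ℂ] (m → ℂ) := (M⁻¹ * E).mulVecLin.toContinuousLinearMap with hFdef
  set G : (m → ℂ) →L[ℂ] (n → ℂ) := (moorePenrose B * Eᴴ).mulVecLin.toContinuousLinearMap with hGdef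
  have hFa : ∀ y, F y = M⁻¹ *ᵥ (E *ᵥ y) := fun y => by simp [hFdef]
  have hGa : ∀ x, G x = moorePenrose B *ᵥ (Eᴴ *ᵥ x) := fun x => by simp [hGdef]
  have hy : ∀ k, u (k + 1) ∘ Sum.inr - w₂ = (u k ∘ Sum.inr - w₂) -
      (τ : ℂ) • (((ω₁ : ℂ) - 1) • G (u k ∘ Sum.inl - w₁) +
        (ω₁ : ℂ) • G (F (u k ∘ Sum.inr - w₂))) := by
    intro k
    simp only [hu1, gstsStep, Sum.elim_comp_inr, gstsSecond, hf₁, hf₂, hFa, hGa, hM1, hS,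
      mulVec_add, mulVec_sub, mulVec_smul, mulVec_neg]
    module
  have hx : ∀ k, u (k + 1) ∘ Sum.inl - w₁ = (1 - (τ : ℂ)) • (u k ∘ Sum.inl - w₁) -
      (τ : ℂ) • F (u k ∘ Sum.inr - w₂) -
      (ω₂ : ℂ) • F ((u (k + 1) ∘ Sum.inr - w₂) - (u k ∘ Sum.inr - w₂)) := by
    intro k
    have h2 : u (k + 1) ∘ Sum.inr = gstsSecond M E B ω₁ τ (f ∘ Sum.inl) (f ∘ Sum.inr)
        (u k ∘ Sum.inl) (u k ∘ Sum.inr) := by rw [hu1, gstsStep, Sum.elim_comp_inr]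
    have h1 : u (k + 1) ∘ Sum.inl = gstsFirst M E ω₂ τ (f ∘ Sum.inl) (u k ∘ Sum.inl)
        (u k ∘ Sum.inr) (u (k + 1) ∘ Sum.inr) := by
      rw [h2, hu1, gstsStep, Sum.elim_comp_inl]
    rw [h1]
    simp only [gstsFirst, hf₁, hFa, hM1, mulVec_add, mulVec_sub, mulVec_smul]
    module
  obtain ⟨hlx, hly⟩ := tendsto_gsts_error F G (fun y => by simp only [hFa, hGa, hS, hE])
    (fun x => by simp only [hFa, hGa, hS, hP]) hμ hν hτ hadd hmul
    (x := fun k => u k ∘ Sum.inl - w₁) (y := fun k => u k ∘ Sum.inr - w₂) hy hx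
  -- The surviving error `d` lies in the kernel of `E`, so adding it to `w₂` gives another solution.
  set d := (u 0 ∘ Sum.inr - w₂) - G (F (u 0 ∘ Sum.inr - w₂)) with hd
  have hEd : E *ᵥ d = 0 := by
    rw [hd, hFa, hGa, hS, mulVec_sub, hE, sub_self]
  refine ⟨Sum.elim w₁ (w₂ + d), ?_, ?_⟩
  · simp only [hf, saddleMatrix, fromBlocks_mulVec, Sum.elim_comp_inl, Sum.elim_comp_inr,
      mulVec_add, hEd, add_zero, zero_mulVec]
  · rw [tendsto_pi_nhds] at hlx hly ⊢
    rintro (i | i)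
    · simpa using (hlx i).add_const (w₁ i)
    · simpa [add_comm] using (hly i).add_const (w₂ i)

end GSTS

theorem mainTheorem3 (p q : ℕ) (M : Matrix (Fin p) (Fin p) ℂ) (hM : M.PosDef)
    (E : Matrix (Fin p) (Fin q) ℂ) (B : Matrix (Fin q) (Fin q) ℂ) (hB : B = Eᴴ * M⁻¹ * E)
    (ω₁ ω₂ τ ω : ℝ) (hω : ω = (ω₁ - 1) * (ω₂ - 1)) (hω2 : ω < 2)
    (ha : 0 ≤ ω → 0 < τ ∧ τ < 2 - ω)
    (hb : ω < 0 → 0 < τ ∧ τ < 2 - ω - Real.sqrt (ω * (ω - 4))) :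
    IsSemiConvergent (saddleMatrix M E) (gstsMatrixStep M E B ω₁ ω₂ τ) ∧
      IsSemiConvergent (saddleMatrix M E) (gstsStep M E B ω₁ ω₂ τ) := by
  rw [gstsMatrixStep_eq_gstsStep hM hB, and_self]
  obtain ⟨μ, ν, hμ, hν, hadd, hmul⟩ := exists_gsts_roots hω2 ha hb
  have hωc : (ω : ℂ) = ((ω₁ : ℂ) - 1) * (ω₂ - 1) := by rw [hω]; push_cast; ring
  rw [hωc] at hadd hmul
  refine isSemiConvergent_gstsStep hM hB hμ hν ?_ hadd hmul
  have h := abs_one_sub_lt_one_of_gsts ha hb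
  rw [← Real.norm_eq_abs, ← Complex.norm_real] at h
  simpa using h
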